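/- Let $k$ be an algebraically closed field of characteristic $0$. A connected graded algebra is an $\mathbb N$-graded $k$-algebra $A=\bigoplus_{i\in\mathbb N}A_i$ with $A_0=k$; $\operatorname{GrMod}A$ denotes the $k$-linear category of $\mathbb Z$-graded right $A$-modules with degree-preserving $A$-linear maps; and $$\operatorname{GKdim}A=\inf\{d\in\mathbb R^+\mid \dim_kA_i\le c\,i^{d-1}\text{ for some constant }c>0\text{ and all }i\gg0\}.$$ Let $RN(A)_1$ be the set of elements $w\in A_1$ that are regular (neither left nor right zero divisors), normal ($Aw=wA$) and not units. For $w\in RN(A)_1$ let $\nu$ be the automorphism of $A$ with $fw=w\nu(f)$ for all $f\in A$, and define the dehomogenization of $A$ with respect to $w$ to be the $k$-algebra $$\mathscr D_w(A)=A[w^{-1}]_0=\{fw^{-i}\mid i\in\mathbb N,\ f\in A_i\},$$ where $fw^{-i}=gw^{-j}$ if and only if $fw^j=gw^i$, with $$fw^{-i}+gw^{-j}=(fw^j+gw^i)w^{-i-j},\qquad (fw^{-i})(gw^{-j})=f\nu^i(g)w^{-i-j}.$$ Let $A$ and $A'$ be right noetherian connected graded $k$-algebras, finitely generated in degree $1$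 over $k$, with $\operatorname{GKdim}A=\operatorname{GKdim}A'=1$. If $\operatorname{GrMod}A$ and $\operatorname{GrMod}A'$ are equivalent as $k$-linear categories, then for all $w\in RN(A)_1$ and $w'\in RN(A')_1$ we have $\mathscr D_w(A)\cong\mathscr D_{w'}(A')$ as $k$-algebras. In particular, $\mathscr D_{w_1}(A)\cong\mathscr D_{w_2}(A)$ as $k$-algebras for all $w_1,w_2\in RN(A)_1$. -/

import Mathlib

open CategoryTheory

universe v u

set_option linter.unusedSectionVars false

noncomputable section

namespace GrAlg

/-! ### Connected graded algebras

A `ℤ`-graded `k`-algebra is a `k`-algebra `A` with a family `𝒜 : ℤ → Submodule k A` and an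
instance `GradedAlgebra 𝒜`. -/

section Algebras

variable {k : Type v} [Field k] {A : Type u} [Ring A] [Algebra k A]

/-- `A` is connected graded: `A = ⨁_{i ≥ 0} A_i` and `A_0 = k`
(that is, `A` is not the zero ring and `A_0` is the image of `k`). -/
structure IsConnected (𝒜 : ℤ → Submodule k A) : Prop where
  nontrivial : Nontrivial A
  neg_eq_bot : ∀ i : ℤ, i < 0 → 𝒜 i = ⊥
  zero_eq : (𝒜 0 : Set A) = Set.range (algebraMap k A)

/-- `A` is generated as a `k`-algebra by finitely many elements of degree `1`. -/
def IsFinGenInDegreeOne (𝒜 : ℤ → Submodule k A) : Prop :=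
  ∃ s : Finset A, (∀ x ∈ s, x ∈ 𝒜 1) ∧ Algebra.adjoin k (s : Set A) = ⊤

/-- `A` is right noetherian: right `A`-modules are left modules over `Aᵐᵒᵖ`. -/
def IsRightNoetherian (A : Type u) [Ring A] : Prop := IsNoetherianRing Aᵐᵒᵖ

/-- The Gelfand–Kirillov dimension
`inf {d ∈ ℝ⁺ | dim_k A_i ≤ c i ^ (d - 1) for some c > 0 and all i ≫ 0}`, with value `⊤` if there
is no such `d`. -/
def GKdim (𝒜 : ℤ → Submodule k A) : EReal :=
  sInf ((fun d : ℝ => (d : EReal)) '' {d : ℝ | 0 < d ∧ ∃ c : ℝ, 0 < c ∧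
    ∀ᶠ i : ℕ in Filter.atTop, Module.Finite k (𝒜 (i : ℤ)) ∧
      (Module.finrank k (𝒜 (i : ℤ)) : ℝ) ≤ c * (i : ℝ) ^ (d - 1)})

end Algebras

/-! ### The category of graded right modules -/

/-- A `ℤ`-graded right module over the graded algebra `𝒜`. -/
structure GrMod {k : Type v} [Field k] {A : Type u} [Ring A] [Algebra k A]
    (𝒜 : ℤ → Submodule k A) where
  carrier : Type u
  [addCommGroup : AddCommGroup carrier]
  [moduleBase : Module k carrier]
  [module : Module Aᵐᵒᵖ carrier]
  [isScalarTower : IsScalarTower k Aᵐᵒᵖ carrier]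
  /-- the homogeneous component of degree `i` -/
  deg : ℤ → Submodule k carrier
  isInternal : DirectSum.IsInternal deg
  smul_mem : ∀ (i j : ℤ) (m : carrier) (a : A), m ∈ deg i → a ∈ 𝒜 j →
    MulOpposite.op a • m ∈ deg (i + j)

namespace GrMod

attribute [instance] addCommGroup moduleBase module isScalarTower

variable {k : Type v} [Field k] {A : Type u} [Ring A] [Algebra k A] {𝒜 : ℤ → Submodule k A}

/-- The `k`-vector space of right `A`-linear maps that preserve degrees. -/
def homs (M N : GrMod 𝒜) : Submodule k (M.carrier →ₗ[Aᵐᵒᵖ] N.carrier) where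
  carrier := {f | ∀ (i : ℤ) (m : M.carrier), m ∈ M.deg i → f m ∈ N.deg i}
  add_mem' := fun hf hg i m hm => (N.deg i).add_mem (hf i m hm) (hg i m hm)
  zero_mem' := fun i _ _ => (N.deg i).zero_mem
  smul_mem' := fun c _ hf i m hm => (N.deg i).smul_mem c (hf i m hm)

instance : Category (GrMod 𝒜) where
  Hom M N := homs M N
  id M := ⟨LinearMap.id, fun _ _ hm => hm⟩
  comp f g := ⟨g.1.comp f.1, fun i m hm => g.2 i _ (f.2 i m hm)⟩

instance : Preadditive (GrMod 𝒜) where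
  homGroup M N := inferInstanceAs (AddCommGroup (homs M N))
  add_comp _ _ _ f f' g := Subtype.ext (LinearMap.ext fun m => map_add g.1 (f.1 m) (f'.1 m))
  comp_add _ _ _ _ _ _ := Subtype.ext (LinearMap.ext fun _ => rfl)

instance : Linear k (GrMod 𝒜) where
  homModule M N := inferInstanceAs (Module k (homs M N))
  smul_comp _ _ _ c f g := Subtype.ext (LinearMap.ext fun m => by
    change g.1 (c • f.1 m) = c • g.1 (f.1 m)
    exact LinearMap.map_smul_of_tower g.1 c (f.1 m))
  comp_smul _ _ _ f c g := Subtype.ext (LinearMap.ext fun _ => rfl)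

end GrMod

/-- `GrMod A ≅ GrMod A'`: the categories are equivalent as `k`-linear categories. -/
def GrModEquivalent {k : Type v} [Field k]
    {A : Type u} [Ring A] [Algebra k A] (𝒜 : ℤ → Submodule k A)
    {A' : Type u} [Ring A'] [Algebra k A'] (𝒜' : ℤ → Submodule k A') : Prop :=
  ∃ e : GrMod 𝒜 ≌ GrMod 𝒜', e.functor.Additive ∧ e.functor.Linear k

/-! ### Regular normal elements and the normalizing automorphism -/

section RegularNormal

variable {k : Type v} [Field k] {A : Type u} [Ring A] [Algebra k A]

/-- `f` is normal: `A f = f A`. -/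
def IsNormalElt (f : A) : Prop := Set.range (fun a : A => a * f) = Set.range (fun a : A => f * a)

/-- `RN(A)_d`: the homogeneous regular normal elements of degree `d` which are not units. -/
def RN (𝒜 : ℤ → Submodule k A) (d : ℤ) : Set A :=
  {w | w ∈ 𝒜 d ∧ IsRegular w ∧ IsNormalElt w ∧ ¬ IsUnit w}

variable {𝒜 : ℤ → Submodule k A} {d : ℤ}

lemma RN.exists_mul_eq (w : RN 𝒜 d) (f : A) : ∃ g : A, f * w.1 = w.1 * g := by
  have h : f * w.1 ∈ Set.range (fun a : A => w.1 * a) := w.2.2.2.1 ▸ ⟨f, rfl⟩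
  obtain ⟨g, hg⟩ := h
  exact ⟨g, hg.symm⟩

lemma RN.exists_mul_eq' (w : RN 𝒜 d) (g : A) : ∃ f : A, f * w.1 = w.1 * g := by
  have h : w.1 * g ∈ Set.range (fun a : A => a * w.1) := w.2.2.2.1 ▸ ⟨g, rfl⟩
  exact h

lemma RN.left_cancel (w : RN 𝒜 d) {a b : A} (h : w.1 * a = w.1 * b) : a = b :=
  w.2.2.1.left h

lemma RN.right_cancel (w : RN 𝒜 d) {a b : A} (h : a * w.1 = b * w.1) : a = b :=
  w.2.2.1.right h

lemma RN.right_cancel_pow (w : RN 𝒜 d) (n : ℕ) {a b : A} (h : a * w.1 ^ n = b * w.1 ^ n) :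
    a = b :=
  (w.2.2.1.pow n).right h

/-- The normalizing automorphism `ν` of `w` as a map: `f w = w ν(f)`. -/
def RN.nuFun (w : RN 𝒜 d) (f : A) : A := (RN.exists_mul_eq w f).choose

lemma RN.nuFun_spec (w : RN 𝒜 d) (f : A) : f * w.1 = w.1 * RN.nuFun w f :=
  (RN.exists_mul_eq w f).choose_spec

/-- The normalizing automorphism `ν` of `w`. -/
def RN.nu (w : RN 𝒜 d) : A ≃ₐ[k] A :=
  AlgEquiv.ofBijective
    { toFun := RN.nuFun w
      map_one' := RN.left_cancel w (by rw [← RN.nuFun_spec w]; simp)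
      map_mul' := fun a b => RN.left_cancel w (by
        rw [← RN.nuFun_spec w, mul_assoc, RN.nuFun_spec w b, ← mul_assoc, RN.nuFun_spec w a, mul_assoc])
      map_zero' := RN.left_cancel w (by rw [← RN.nuFun_spec w]; simp)
      map_add' := fun a b => RN.left_cancel w (by
        rw [← RN.nuFun_spec w, mul_add, add_mul, RN.nuFun_spec w a, RN.nuFun_spec w b])
      commutes' := fun c => RN.left_cancel w (by
        rw [← RN.nuFun_spec w]; exact Algebra.commutes c w.1) }
    ⟨fun a b h => RN.right_cancel w (by
        have h' : RN.nuFun w a = RN.nuFun w b := h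
        rw [RN.nuFun_spec w a, RN.nuFun_spec w b, h']),
      fun g => by
        obtain ⟨f, hf⟩ := RN.exists_mul_eq' w g
        exact ⟨f, RN.left_cancel w ((RN.nuFun_spec w f).symm.trans hf)⟩⟩

/-- The defining property of the normalizing automorphism. -/
lemma RN.mul_eq (w : RN 𝒜 d) (f : A) : f * w.1 = w.1 * RN.nu w f := RN.nuFun_spec w f

lemma RN.nu_self (w : RN 𝒜 d) : RN.nu w w.1 = w.1 := RN.left_cancel w (RN.mul_eq w w.1).symm

lemma RN.nu_mem [GradedAlgebra 𝒜] (w : RN 𝒜 d) {i : ℤ} {f : A} (hf : f ∈ 𝒜 i) :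
    RN.nu w f ∈ 𝒜 i := by
  have h1 : w.1 * RN.nu w f ∈ 𝒜 (d + i) := by
    rw [← RN.mul_eq w, add_comm]
    exact SetLike.mul_mem_graded hf w.2.1
  have h2 := DirectSum.coe_decompose_mul_add_of_left_mem 𝒜 (b := RN.nu w f) (j := i) w.2.1
  rw [DirectSum.decompose_of_mem_same 𝒜 h1] at h2
  rw [RN.left_cancel w h2]
  exact SetLike.coe_mem _

lemma RN.nu_pow_succ (w : RN 𝒜 d) (n : ℕ) (f : A) :
    (RN.nu w ^ (n + 1)) f = RN.nu w ((RN.nu w ^ n) f) := by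
  rw [pow_succ', AlgEquiv.mul_apply]

lemma RN.nu_pow_add (w : RN 𝒜 d) (m n : ℕ) (f : A) :
    (RN.nu w ^ (m + n)) f = (RN.nu w ^ m) ((RN.nu w ^ n) f) := by
  rw [pow_add, AlgEquiv.mul_apply]

lemma RN.nu_pow_self (w : RN 𝒜 d) (n : ℕ) : (RN.nu w ^ n) w.1 = w.1 := by
  induction n with
  | zero => simp
  | succ n ih => rw [RN.nu_pow_succ w, ih, RN.nu_self w]

lemma RN.nu_pow_mem [GradedAlgebra 𝒜] (w : RN 𝒜 d) (n : ℕ) {i : ℤ} {f : A} (hf : f ∈ 𝒜 i) :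
    (RN.nu w ^ n) f ∈ 𝒜 i := by
  induction n with
  | zero => simpa using hf
  | succ n ih => rw [RN.nu_pow_succ w]; exact RN.nu_mem w ih

lemma RN.mul_pow_eq (w : RN 𝒜 d) (n : ℕ) (f : A) :
    f * w.1 ^ n = w.1 ^ n * (RN.nu w ^ n) f := by
  induction n with
  | zero => simp
  | succ n ih =>
    rw [pow_succ, ← mul_assoc, ih, mul_assoc, RN.mul_eq w, ← mul_assoc, RN.nu_pow_succ w]

lemma RN.pow_mem [GradedAlgebra 𝒜] (w : RN 𝒜 1) (n : ℕ) : w.1 ^ n ∈ 𝒜 (n : ℤ) := by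
  have h := SetLike.pow_mem_graded n w.2.1
  simpa using h

end RegularNormal

/-! ### Dehomogenization -/

section Dehomogenization

variable {k : Type v} [Field k] {A : Type u} [Ring A] [Algebra k A]
  {𝒜 : ℤ → Submodule k A} [GradedAlgebra 𝒜]

/-- A formal fraction `f w⁻ⁱ` with `f ∈ A_i`. -/
structure PreFrac (w : RN 𝒜 1) where
  num : A
  den : ℕ
  num_mem : num ∈ 𝒜 (den : ℤ)

/-- `f w⁻ⁱ = g w⁻ʲ` if and only if `f wʲ = g wⁱ`. -/
instance PreFrac.setoid (w : RN 𝒜 1) : Setoid (PreFrac w) where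
  r x y := x.num * w.1 ^ y.den = y.num * w.1 ^ x.den
  iseqv :=
    { refl := fun _ => rfl
      symm := fun h => h.symm
      trans := by
        intro x y z h1 h2
        apply RN.right_cancel_pow w y.den
        have e1 : x.num * w.1 ^ y.den * w.1 ^ z.den = y.num * w.1 ^ x.den * w.1 ^ z.den :=
          congrArg (· * w.1 ^ z.den) h1
        have e2 : y.num * w.1 ^ z.den * w.1 ^ x.den = z.num * w.1 ^ y.den * w.1 ^ x.den :=
          congrArg (· * w.1 ^ x.den) h2
        simp only [mul_assoc, ← pow_add] at e1 e2 ⊢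
        rw [add_comm z.den, e1, add_comm x.den, e2, add_comm y.den] }

/-- The dehomogenization `𝒟_w(A) = A[w⁻¹]_0 = {f w⁻ⁱ | f ∈ A_i, i ∈ ℕ}`. -/
def Dehom (w : RN 𝒜 1) : Type u := Quotient (PreFrac.setoid w)

namespace Dehom

variable {w : RN 𝒜 1}

/-- The element `f w⁻ⁱ`. -/
def mk (w : RN 𝒜 1) (f : A) (i : ℕ) (hf : f ∈ 𝒜 (i : ℤ)) : Dehom w :=
  Quotient.mk (PreFrac.setoid w) ⟨f, i, hf⟩

lemma mk_eq {f g : A} {i j : ℕ} {hf : f ∈ 𝒜 (i : ℤ)} {hg : g ∈ 𝒜 (j : ℤ)} :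
    mk w f i hf = mk w g j hg ↔ f * w.1 ^ j = g * w.1 ^ i := Quotient.eq

lemma ind {p : Dehom w → Prop} (h : ∀ f i hf, p (mk w f i hf)) (x : Dehom w) : p x :=
  Quotient.ind (fun y => h y.num y.den y.num_mem) x

lemma mul_mem {f g : A} {i j : ℕ} (hf : f ∈ 𝒜 (i : ℤ)) (hg : g ∈ 𝒜 (j : ℤ)) :
    f * g ∈ 𝒜 ((i + j : ℕ) : ℤ) := by
  rw [Nat.cast_add]
  exact SetLike.mul_mem_graded hf hg

lemma add_mem (w : RN 𝒜 1) {f g : A} {i j : ℕ} (hf : f ∈ 𝒜 (i : ℤ)) (hg : g ∈ 𝒜 (j : ℤ)) :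
    f * w.1 ^ j + g * w.1 ^ i ∈ 𝒜 ((i + j : ℕ) : ℤ) :=
  (𝒜 _).add_mem (mul_mem hf (RN.pow_mem w j)) (by
    rw [add_comm i j]
    exact mul_mem hg (RN.pow_mem w i))

/-- `f w⁻ⁱ + g w⁻ʲ = (f wʲ + g wⁱ) w⁻ⁱ⁻ʲ`. -/
instance : Add (Dehom w) where
  add := Quotient.map₂
    (fun x y => ⟨x.num * w.1 ^ y.den + y.num * w.1 ^ x.den, x.den + y.den,
      add_mem w x.num_mem y.num_mem⟩)
    (by
      intro x x' hx y y' hy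
      change x.num * w.1 ^ x'.den = x'.num * w.1 ^ x.den at hx
      change y.num * w.1 ^ y'.den = y'.num * w.1 ^ y.den at hy
      change (x.num * w.1 ^ y.den + y.num * w.1 ^ x.den) * w.1 ^ (x'.den + y'.den) =
        (x'.num * w.1 ^ y'.den + y'.num * w.1 ^ x'.den) * w.1 ^ (x.den + y.den)
      have e1 : x.num * w.1 ^ x'.den * w.1 ^ (y.den + y'.den) =
          x'.num * w.1 ^ x.den * w.1 ^ (y.den + y'.den) := by rw [hx]
      have e2 : y.num * w.1 ^ y'.den * w.1 ^ (x.den + x'.den) =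
          y'.num * w.1 ^ y.den * w.1 ^ (x.den + x'.den) := by rw [hy]
      simp only [add_mul, mul_assoc, ← pow_add] at e1 e2 ⊢
      congr 1
      · convert e1 using 3 <;> ring
      · convert e2 using 3 <;> ring)

/-- `(f w⁻ⁱ) (g w⁻ʲ) = f νⁱ(g) w⁻ⁱ⁻ʲ`, with `ν` the normalizing automorphism of `w`. -/
instance : Mul (Dehom w) where
  mul := Quotient.map₂
    (fun x y => ⟨x.num * (RN.nu w ^ x.den) y.num, x.den + y.den,
      mul_mem x.num_mem (RN.nu_pow_mem w x.den y.num_mem)⟩)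
    (by
      intro x x' hx y y' hy
      change x.num * w.1 ^ x'.den = x'.num * w.1 ^ x.den at hx
      change y.num * w.1 ^ y'.den = y'.num * w.1 ^ y.den at hy
      change x.num * (RN.nu w ^ x.den) y.num * w.1 ^ (x'.den + y'.den) =
        x'.num * (RN.nu w ^ x'.den) y'.num * w.1 ^ (x.den + y.den)
      have e : (RN.nu w ^ x.den) y.num * w.1 ^ y'.den = (RN.nu w ^ x.den) y'.num * w.1 ^ y.den := by
        have := congrArg (RN.nu w ^ x.den) hy
        simpa only [map_mul, map_pow, RN.nu_pow_self w] using this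
      calc x.num * (RN.nu w ^ x.den) y.num * w.1 ^ (x'.den + y'.den)
          = x.num * ((RN.nu w ^ x.den) y.num * w.1 ^ y'.den) * w.1 ^ x'.den := by
            rw [add_comm, pow_add]; simp only [mul_assoc]
        _ = x.num * ((RN.nu w ^ x.den) y'.num * w.1 ^ x'.den) * w.1 ^ y.den := by
            rw [e]; simp only [mul_assoc, ← pow_add]; rw [add_comm x'.den]
        _ = x.num * w.1 ^ x'.den * (RN.nu w ^ (x'.den + x.den)) y'.num * w.1 ^ y.den := by
            rw [RN.mul_pow_eq w x'.den, RN.nu_pow_add w]; simp only [mul_assoc]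
        _ = x'.num * (w.1 ^ x.den * (RN.nu w ^ x.den) ((RN.nu w ^ x'.den) y'.num)) * w.1 ^ y.den := by
            rw [hx, add_comm x'.den, RN.nu_pow_add w]; simp only [mul_assoc]
        _ = x'.num * (RN.nu w ^ x'.den) y'.num * w.1 ^ (x.den + y.den) := by
            rw [← RN.mul_pow_eq w, pow_add]; simp only [mul_assoc])

lemma algebraMap_mem (c : k) : algebraMap k A c ∈ 𝒜 ((0 : ℕ) : ℤ) := by
  rw [Nat.cast_zero]
  exact SetLike.algebraMap_mem_graded 𝒜 c

instance : Zero (Dehom w) where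
  zero := mk w 0 0 (𝒜 _).zero_mem

instance : One (Dehom w) where
  one := mk w 1 0 (by rw [Nat.cast_zero]; exact SetLike.one_mem_graded 𝒜)

instance : Neg (Dehom w) where
  neg := Quotient.map (fun x => ⟨-x.num, x.den, (𝒜 _).neg_mem x.num_mem⟩) (by
    intro x y h
    change x.num * w.1 ^ y.den = y.num * w.1 ^ x.den at h
    change -x.num * w.1 ^ y.den = -y.num * w.1 ^ x.den
    rw [neg_mul, neg_mul, h])

lemma mk_add (f g : A) (i j : ℕ) (hf : f ∈ 𝒜 (i : ℤ)) (hg : g ∈ 𝒜 (j : ℤ)) :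
    mk w f i hf + mk w g j hg = mk w (f * w.1 ^ j + g * w.1 ^ i) (i + j) (add_mem w hf hg) := rfl

lemma mk_mul (f g : A) (i j : ℕ) (hf : f ∈ 𝒜 (i : ℤ)) (hg : g ∈ 𝒜 (j : ℤ)) :
    mk w f i hf * mk w g j hg =
      mk w (f * (RN.nu w ^ i) g) (i + j) (mul_mem hf (RN.nu_pow_mem w i hg)) := rfl

lemma mk_neg (f : A) (i : ℕ) (hf : f ∈ 𝒜 (i : ℤ)) :
    -mk w f i hf = mk w (-f) i ((𝒜 _).neg_mem hf) := rfl

lemma zero_def : (0 : Dehom w) = mk w 0 0 (𝒜 _).zero_mem := rfl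

lemma one_def : (1 : Dehom w) =
    mk w 1 0 (by rw [Nat.cast_zero]; exact SetLike.one_mem_graded 𝒜) := rfl

lemma mk_congr {f g : A} {i j : ℕ} {hf : f ∈ 𝒜 (i : ℤ)} {hg : g ∈ 𝒜 (j : ℤ)}
    (h : f = g) (h' : i = j) : mk w f i hf = mk w g j hg := by
  subst h h'; rfl

instance : Ring (Dehom w) where
  add_assoc := by
    refine ind fun f i hf => ind fun g j hg => ind fun h l hh => ?_
    simp only [mk_add]
    refine mk_congr ?_ (add_assoc _ _ _)
    simp only [add_mul, mul_assoc, ← pow_add, add_assoc]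
    rw [add_comm j i, add_comm l i]
  zero_add := by
    refine ind fun f i hf => ?_
    rw [zero_def, mk_add]
    exact mk_congr (by simp) (by simp)
  add_zero := by
    refine ind fun f i hf => ?_
    rw [zero_def, mk_add]
    exact mk_congr (by simp) (by simp)
  add_comm := by
    refine ind fun f i hf => ind fun g j hg => ?_
    rw [mk_add, mk_add]
    exact mk_congr (add_comm _ _) (add_comm _ _)
  neg_add_cancel := by
    refine ind fun f i hf => ?_
    rw [zero_def, mk_neg, mk_add, mk_eq]
    simp
  mul_assoc := by
    refine ind fun f i hf => ind fun g j hg => ind fun h l hh => ?_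
    simp only [mk_mul]
    refine mk_congr ?_ (add_assoc _ _ _)
    rw [map_mul, RN.nu_pow_add w, mul_assoc]
  one_mul := by
    refine ind fun f i hf => ?_
    rw [one_def, mk_mul]
    exact mk_congr (by simp) (by simp)
  mul_one := by
    refine ind fun f i hf => ?_
    rw [one_def, mk_mul]
    exact mk_congr (by simp) (by simp)
  left_distrib := by
    refine ind fun f i hf => ind fun g j hg => ind fun h l hh => ?_
    simp only [mk_mul, mk_add]
    rw [mk_eq]
    simp only [map_add, map_mul, map_pow, RN.nu_pow_self w, mul_add, add_mul, mul_assoc, ← pow_add]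
    congr 4 <;> ring
  right_distrib := by
    refine ind fun f i hf => ind fun g j hg => ind fun h l hh => ?_
    simp only [mk_mul, mk_add]
    rw [mk_eq]
    have e1 : w.1 ^ j * (RN.nu w ^ (i + j)) h = (RN.nu w ^ i) h * w.1 ^ j := by
      rw [RN.mul_pow_eq w, ← RN.nu_pow_add w, add_comm]
    have e2 : w.1 ^ i * (RN.nu w ^ (i + j)) h = (RN.nu w ^ j) h * w.1 ^ i := by
      rw [RN.mul_pow_eq w, ← RN.nu_pow_add w]
    simp only [add_mul, mul_assoc]
    rw [← mul_assoc (w.1 ^ j), e1, ← mul_assoc (w.1 ^ i), e2]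
    simp only [mul_assoc, ← pow_add]
    congr 4 <;> ring
  zero_mul := by
    refine ind fun f i hf => ?_
    rw [zero_def, mk_mul, mk_eq]
    simp
  mul_zero := by
    refine ind fun f i hf => ?_
    rw [zero_def, mk_mul, mk_eq]
    simp
  nsmul := nsmulRec
  zsmul := zsmulRec

/-- The `k`-algebra structure: `c ↦ c w⁰`. -/
instance : Algebra k (Dehom w) :=
  RingHom.toAlgebra'
    { toFun := fun c => mk w (algebraMap k A c) 0 (algebraMap_mem c)
      map_one' := mk_congr (map_one _) rfl
      map_mul' := fun a b => by
        rw [mk_mul]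
        exact mk_congr (by simp) rfl
      map_zero' := mk_congr (map_zero _) rfl
      map_add' := fun a b => by
        rw [mk_add]
        exact mk_congr (by simp) rfl }
    (by
      intro c
      refine ind fun f i hf => ?_
      change mk w (algebraMap k A c) 0 (algebraMap_mem c) * mk w f i hf =
        mk w f i hf * mk w (algebraMap k A c) 0 (algebraMap_mem c)
      rw [mk_mul, mk_mul]
      refine mk_congr ?_ (add_comm _ _)
      rw [AlgEquiv.commutes, pow_zero, AlgEquiv.one_apply]
      exact Algebra.commutes c f)

end Dehom

end Dehomogenization

end GrAlg

end

/-! Write `D'` for the dehomogenization of `A'` at `w'`. A `k`-linear equivalence carries each shift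
`A(i)` to some `A'(σ i)`: the shift covers a simple module, and any morphism into it that survives
on that quotient splits (`GrMod.exists_section`, `GrMod.exists_iso_shift`). Since `Hom(A(i), A(j)) =
A_{j-i}`, this identifies `A_{j-i}` with `A'_{σ j - σ i}` compatibly with composition, and `w`
forces `σ` to be strictly increasing.

GK dimension one makes right multiplication by `w'` bijective in large degrees, so `D'` is
finite-dimensional and equals `A'_m w'⁻ᵐ` for every large `m`.

Composing the two gives injections `θ_n : A_n → D'`. They are not multiplicative, because the right
factor of a product is read off at a different shift; but right multiplication by `b` still becomes
right multiplication by some element of `D'`. Each `θ_n(wⁿ)` is a unit, since left multiplication by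
it is injective on a finite-dimensional space. Then `f w⁻ⁿ ↦ θ_n(f) θ_n(wⁿ)⁻¹` is an algebra
isomorphism (`Dehom.nonempty_algEquiv`). Comparing two elements of the same `A` is the case of the
identity equivalence. -/

namespace GrAlg

noncomputable section

/-! ### Isomorphisms out of a dehomogenization -/

section Transfer

variable {k : Type v} [Field k] {A : Type u} [Ring A] [Algebra k A]
  {𝒜 : ℤ → Submodule k A} [GradedAlgebra 𝒜]

/-- A ring `D` is the dehomogenization `A[w⁻¹]_0` as soon as the homogeneous components of `A`
embed into `D` compatibly with right multiplications, in such a way that the powers of `w` become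
units and every element of `D` is a fraction. -/
theorem Dehom.nonempty_algEquiv (w : RN 𝒜 1) {D : Type*} [Ring D] [Algebra k D]
    (θ : ∀ n : ℕ, 𝒜 (n : ℤ) →ₗ[k] D)
    (hinj : ∀ n, Function.Injective (θ n))
    (hmul : ∀ (n m : ℕ) (b : 𝒜 (m : ℤ)), ∃ y : D, ∀ a : 𝒜 (n : ℤ),
      θ (n + m) ⟨a.1 * b.1, Dehom.mul_mem a.2 b.2⟩ = θ n a * y)
    (hunit : ∀ n, IsUnit (θ n ⟨w.1 ^ n, RN.pow_mem w n⟩))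
    (hsurj : ∀ y : D, ∃ (n : ℕ) (f : 𝒜 (n : ℤ)), θ n f = y * θ n ⟨w.1 ^ n, RN.pow_mem w n⟩) :
    Nonempty (Dehom w ≃ₐ[k] D) := by
  choose u hu using hunit
  -- Transport between equal degrees such as `i + j` and `j + i`, whose components are different
  -- types.
  have hθ : ∀ {n m : ℕ} (_ : n = m) (a : A) (ha : a ∈ 𝒜 (n : ℤ)) (hb : a ∈ 𝒜 (m : ℤ)),
      θ n ⟨a, ha⟩ * ↑(u n)⁻¹ = θ m ⟨a, hb⟩ * ↑(u m)⁻¹ := by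
    rintro n m rfl a ha hb; rfl
  -- Expanding a fraction by `wʲ` multiplies both `θ n f` and `u n` on the right by the same `y`,
  -- which cancels.
  have key : ∀ (n j : ℕ) (f : 𝒜 (n : ℤ)),
      θ (n + j) ⟨f.1 * w.1 ^ j, Dehom.mul_mem f.2 (RN.pow_mem w j)⟩ * ↑(u (n + j))⁻¹ =
        θ n f * ↑(u n)⁻¹ := by
    intro n j f
    obtain ⟨y, hy⟩ := hmul n j ⟨w.1 ^ j, RN.pow_mem w j⟩
    have h1 : (u (n + j) : D) = u n * y := by
      rw [hu, hu, ← hy]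
      congr 2
      exact pow_add _ _ _
    have h2 : ((u n)⁻¹ : Dˣ) * (u (n + j) : D) = y := by rw [h1, Units.inv_mul_cancel_left]
    rw [hy, Units.mul_inv_eq_iff_eq_mul, mul_assoc, h2]
  have keyeq : ∀ (i j : ℕ) (f : 𝒜 (i : ℤ)) (g : 𝒜 (j : ℤ)),
      θ i f * ↑(u i)⁻¹ = θ j g * ↑(u j)⁻¹ ↔ f.1 * w.1 ^ j = g.1 * w.1 ^ i := by
    intro i j f g
    rw [← key i j f, ← key j i g,
      hθ (add_comm j i) _ _ (by rw [add_comm]; exact Dehom.mul_mem g.2 (RN.pow_mem w i)),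
      Units.mul_left_inj, (hinj _).eq_iff, Subtype.mk.injEq]
  -- The two directions of `keyeq` give well-definedness here and injectivity at the end.
  let Φ : Dehom w → D := Quotient.lift (fun x => θ x.den ⟨x.num, x.num_mem⟩ * ↑(u x.den)⁻¹)
    (fun x y h => (keyeq _ _ _ _).2 h)
  have hΦ : ∀ (f : A) (i : ℕ) (hf : f ∈ 𝒜 (i : ℤ)),
      Φ (Dehom.mk w f i hf) = θ i ⟨f, hf⟩ * ↑(u i)⁻¹ := fun f i hf => rfl
  have hone : ∀ c : k, Φ (algebraMap k _ c) = algebraMap k D c := by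
    intro c
    change Φ (Dehom.mk w (algebraMap k A c) 0 (Dehom.algebraMap_mem c)) = _
    rw [hΦ, Units.mul_inv_eq_iff_eq_mul, hu, Algebra.algebraMap_eq_smul_one (A := D),
      smul_mul_assoc, one_mul, ← map_smul]
    congr 1
    ext
    simp [Algebra.algebraMap_eq_smul_one]
  have hadd : ∀ x y, Φ (x + y) = Φ x + Φ y := by
    refine Dehom.ind fun f i hf => Dehom.ind fun g j hg => ?_
    rw [Dehom.mk_add, hΦ, hΦ, hΦ, ← key i j ⟨f, hf⟩, ← key j i ⟨g, hg⟩,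
      hθ (add_comm j i) _ _ (by rw [add_comm]; exact Dehom.mul_mem hg (RN.pow_mem w i)),
      ← add_mul, ← map_add]
    rfl
  -- Let `y` represent right multiplication by `νⁱ(g)`. From `wⁱ νⁱ(g) = g wⁱ` one gets `u_i y
  -- u_{i+j}⁻¹ = Φ(g w⁻ʲ)`, so the twist in the product is absorbed by `u_i`.
  have hmulΦ : ∀ x y, Φ (x * y) = Φ x * Φ y := by
    refine Dehom.ind fun f i hf => Dehom.ind fun g j hg => ?_
    rw [Dehom.mk_mul, hΦ, hΦ, hΦ]
    obtain ⟨y, hy⟩ := hmul i j ⟨(RN.nu w ^ i) g, RN.nu_pow_mem w i hg⟩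
    have h1 := hy ⟨f, hf⟩
    have h2 := hy ⟨w.1 ^ i, RN.pow_mem w i⟩
    have h3 := key j i ⟨g, hg⟩
    simp only at h1 h2 h3
    rw [hθ (add_comm j i) _ _ (by rw [add_comm]; exact Dehom.mul_mem hg (RN.pow_mem w i))] at h3
    simp only [RN.mul_pow_eq w i g] at h3
    rw [h2, ← hu, mul_assoc] at h3
    rw [h1, mul_assoc, mul_assoc, ← h3, Units.inv_mul_cancel_left]
  refine ⟨AlgEquiv.ofBijective
    { toFun := Φ
      map_one' := by simpa using hone 1
      map_mul' := hmulΦ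
      map_zero' := by simpa using hone 0
      map_add' := hadd
      commutes' := hone } ⟨?_, ?_⟩⟩
  · refine Dehom.ind fun f i hf => Dehom.ind fun g j hg h => ?_
    exact Dehom.mk_eq.2 ((keyeq i j ⟨f, hf⟩ ⟨g, hg⟩).1 h)
  · intro y
    obtain ⟨n, f, hf⟩ := hsurj y
    refine ⟨Dehom.mk w f.1 n f.2, ?_⟩
    change θ n f * ↑(u n)⁻¹ = y
    rw [hf, ← hu, Units.mul_inv_cancel_right]

end Transfer

/-! ### Stabilization of the homogeneous components -/

section Stable

variable {k : Type v} [Field k] {A : Type u} [Ring A] [Algebra k A]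
  {𝒜 : ℤ → Submodule k A} [GradedAlgebra 𝒜]

/-- In an algebra generated in degree one, `A_{n+1} = A_1 A_n`. -/
lemma IsFinGenInDegreeOne.le_mul (hgen : IsFinGenInDegreeOne 𝒜) {n : ℤ} (hn : 0 ≤ n) :
    𝒜 (1 + n) ≤ 𝒜 1 * 𝒜 n := by
  obtain ⟨s, hs, htop⟩ := hgen
  -- Extended to all of `A` as a statement about components of degree `1 + n`, the claim can be
  -- checked on words in the generators. The empty word contributes nothing because `1 + n > 0`.
  have hW : (⊤ : Submodule k A) ≤
      (𝒜 1 * 𝒜 n).comap ((𝒜 (1 + n)).subtype.comp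
        ((DirectSum.component k ℤ (fun i => 𝒜 i) (1 + n)).comp
          (DirectSum.decomposeLinearEquiv 𝒜).toLinearMap)) := by
    rw [← Algebra.top_toSubmodule, ← htop, Algebra.adjoin_eq_span, Submodule.span_le]
    intro x hx
    change (DirectSum.decompose 𝒜 x (1 + n) : A) ∈ 𝒜 1 * 𝒜 n
    induction hx using Submonoid.closure_induction_left with
    | one =>
      rw [DirectSum.decompose_of_mem_ne 𝒜 (SetLike.one_mem_graded 𝒜) (by omega)]
      exact Submodule.zero_mem _
    | mul_left x hx y _ _ =>
      rw [DirectSum.coe_decompose_mul_add_of_left_mem 𝒜 (hs x hx)]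
      exact Submodule.mul_mem_mul (hs x hx) (SetLike.coe_mem _)
  intro x hx
  have h : (DirectSum.decompose 𝒜 x (1 + n) : A) ∈ 𝒜 1 * 𝒜 n := hW (Submodule.mem_top (x := x))
  rwa [DirectSum.decompose_of_mem_same 𝒜 hx] at h

/-- Right multiplication by `w` as a map `A_n → A_{n+1}`. -/
def RN.mulRight (w : RN 𝒜 1) (n : ℕ) : 𝒜 (n : ℤ) →ₗ[k] 𝒜 ((n + 1 : ℕ) : ℤ) :=
  ((LinearMap.mulRight k w.1).comp (𝒜 (n : ℤ)).subtype).codRestrict _ fun f => by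
    have := Dehom.mul_mem f.2 (RN.pow_mem w 1)
    rwa [pow_one] at this

lemma RN.mulRight_injective (w : RN 𝒜 1) (n : ℕ) : Function.Injective (RN.mulRight w n) :=
  fun _ _ h => Subtype.ext (RN.right_cancel w (congrArg Subtype.val h))

/-- Every element of `A_{m+2}` is a sum of products `a b` with `a ∈ A_1`, `b ∈ A_{m+1}`; if `b = c
w`, then `a b = (a c) w`. -/
lemma RN.mulRight_surjective_of_le (hgen : IsFinGenInDegreeOne 𝒜) (w : RN 𝒜 1) {n m : ℕ}
    (h : Function.Surjective (RN.mulRight w n)) (hnm : n ≤ m) :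
    Function.Surjective (RN.mulRight w m) := by
  induction m, hnm using Nat.le_induction with
  | base => exact h
  | succ m _ ih =>
    rintro ⟨x, hx⟩
    have hx' : x ∈ 𝒜 1 * 𝒜 ((m + 1 : ℕ) : ℤ) := by
      refine hgen.le_mul (by positivity) ?_
      convert hx using 2
      push_cast; ring
    suffices H : ∃ y : A, y ∈ 𝒜 ((m + 1 : ℕ) : ℤ) ∧ y * w.1 = x by
      obtain ⟨y, hy, e⟩ := H
      exact ⟨⟨y, hy⟩, Subtype.ext e⟩
    clear hx
    induction hx' using Submodule.mul_induction_on' with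
    | mem_mul_mem a ha b hb =>
      obtain ⟨c, hc⟩ := ih ⟨b, hb⟩
      have hc' : c.1 * w.1 = b := congrArg Subtype.val hc
      refine ⟨a * c.1, ?_, by rw [mul_assoc, hc']⟩
      convert SetLike.mul_mem_graded ha c.2 using 2
      push_cast; ring
    | add a _ b _ iha ihb =>
      obtain ⟨c, hc, rfl⟩ := iha
      obtain ⟨d, hd, rfl⟩ := ihb
      exact ⟨c + d, Submodule.add_mem _ hc hd, add_mul _ _ _⟩

/-- If `GKdim A = 1` then right multiplication by `w` is eventually bijective. -/
lemma RN.exists_mulRight_surjective (hGK : GKdim 𝒜 = 1) (w : RN 𝒜 1) :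
    ∃ n : ℕ, Module.Finite k (𝒜 (n : ℤ)) ∧ Function.Surjective (RN.mulRight w n) := by
  -- What matters is a bound `d < 2`, making `c i ^ (d - 1)` sublinear.
  have hlt : GKdim 𝒜 < ((3 / 2 : ℝ) : EReal) := by
    rw [hGK, ← EReal.coe_one, EReal.coe_lt_coe_iff]; norm_num
  obtain ⟨_, ⟨d, ⟨_, c, hc, hev⟩, rfl⟩, hd⟩ := sInf_lt_iff.1 hlt
  have hd' : d < 3 / 2 := EReal.coe_lt_coe_iff.1 hd
  obtain ⟨N, hN⟩ := Filter.eventually_atTop.1 hev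
  by_contra hcon
  push Not at hcon
  -- An injection of finite-dimensional spaces that is not onto raises the dimension by at least
  -- one.
  have hgrow : ∀ t : ℕ, t ≤ Module.finrank k (𝒜 ((N + t : ℕ) : ℤ)) := by
    intro t
    induction t with
    | zero => exact Nat.zero_le _
    | succ t ih =>
      refine ih.trans_lt ?_
      have := (hN (N + t) (by omega)).1
      have := (hN (N + t + 1) (by omega)).1
      refine lt_of_le_of_ne
        (LinearMap.finrank_le_finrank_of_injective (RN.mulRight_injective w (N + t))) ?_
      intro heq
      exact hcon (N + t) inferInstance
        ((LinearMap.injective_iff_surjective_of_finrank_eq_finrank heq).1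
          (RN.mulRight_injective w (N + t)))
  -- At `i = 2N + M + 1` the dimension is at least `N + M + 1 > i / 2`, whereas `i ^ (-(2 - d)) ≤ 1
  -- / (2c)` bounds it by `i / 2`.
  have hlo := (tendsto_rpow_neg_atTop (show 0 < 2 - d by linarith)).eventually
    (ge_mem_nhds (show (0 : ℝ) < 1 / (2 * c) by positivity))
  obtain ⟨M, hM⟩ := Filter.eventually_atTop.1 (tendsto_natCast_atTop_atTop.eventually hlo)
  have h1 := hgrow (N + M + 1)
  have h2 := (hN (N + (N + M + 1)) (by omega)).2
  have h3 := hM (N + (N + M + 1)) (by omega)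
  have hpos : (0 : ℝ) < ((N + (N + M + 1) : ℕ) : ℝ) := by positivity
  have h4 : c * ((N + (N + M + 1) : ℕ) : ℝ) ^ (d - 1) ≤ ((N + (N + M + 1) : ℕ) : ℝ) / 2 := by
    calc _ = c * (((N + (N + M + 1) : ℕ) : ℝ) ^ (-(2 - d)) * ((N + (N + M + 1) : ℕ) : ℝ)) := by
          rw [← Real.rpow_add_one hpos.ne']; congr 2; ring
      _ ≤ c * (1 / (2 * c) * ((N + (N + M + 1) : ℕ) : ℝ)) := by gcongr
      _ = _ := by field_simp
  have h5 : ((N + M + 1 : ℕ) : ℝ) ≤ ((N + (N + M + 1) : ℕ) : ℝ) / 2 :=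
    (Nat.cast_le.2 h1).trans (h2.trans h4)
  push_cast at h5
  have : (0 : ℝ) ≤ M := by positivity
  linarith

/-! ### Fractions with a fixed denominator -/

lemma Dehom.mk_mul_pow (w : RN 𝒜 1) (f : A) (i n : ℕ) (hf : f ∈ 𝒜 (i : ℤ)) :
    Dehom.mk w f i hf = Dehom.mk w (f * w.1 ^ n) (i + n) (Dehom.mul_mem hf (RN.pow_mem w n)) := by
  rw [Dehom.mk_eq, mul_assoc, ← pow_add, add_comm]

/-- The linear map `f ↦ f w⁻ⁿ` on `A_n`. -/
def Dehom.mkLin (w : RN 𝒜 1) (n : ℕ) : 𝒜 (n : ℤ) →ₗ[k] Dehom w where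
  toFun f := Dehom.mk w f.1 n f.2
  map_add' f g := by
    rw [Dehom.mk_add, Dehom.mk_eq]
    simp [← add_mul, mul_assoc, pow_add]
  map_smul' c f := by
    rw [RingHom.id_apply, Algebra.smul_def]
    change _ = Dehom.mk w (algebraMap k A c) 0 (Dehom.algebraMap_mem c) * _
    rw [Dehom.mk_mul]
    exact Dehom.mk_congr (by simp [Algebra.smul_def]) (by simp)

lemma Dehom.mkLin_injective (w : RN 𝒜 1) (n : ℕ) : Function.Injective (Dehom.mkLin w n) :=
  fun _ _ h => Subtype.ext (RN.right_cancel_pow w n (Dehom.mk_eq.1 h))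

/-- Rewrite `f w⁻ⁱ` as `(f wⁿ) w⁻ⁿ⁻ⁱ` and divide the numerator by `w` on the right `i` times, never
going below degree `n`. -/
lemma Dehom.mkLin_surjective (w : RN 𝒜 1) {n : ℕ}
    (h : ∀ m, n ≤ m → Function.Surjective (RN.mulRight w m)) :
    Function.Surjective (Dehom.mkLin w n) := by
  have hdown : ∀ (j : ℕ) (f : A) (hf : f ∈ 𝒜 ((n + j : ℕ) : ℤ)),
      ∃ a, Dehom.mkLin w n a = Dehom.mk w f (n + j) hf := by
    intro j
    induction j with
    | zero => exact fun f hf => ⟨⟨f, hf⟩, rfl⟩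
    | succ j ih =>
      intro f hf
      obtain ⟨g, hg⟩ := h (n + j) (by omega) ⟨f, hf⟩
      have hg' : g.1 * w.1 = f := congrArg Subtype.val hg
      obtain ⟨a, ha⟩ := ih g.1 g.2
      refine ⟨a, ha.trans ?_⟩
      rw [Dehom.mk_mul_pow w g.1 _ 1]
      exact Dehom.mk_congr (by rw [pow_one, hg']) rfl
  refine Dehom.ind fun f i hf => ?_
  rw [Dehom.mk_mul_pow w f i n]
  obtain ⟨a, ha⟩ := hdown i (f * w.1 ^ n)
    (by rw [add_comm]; exact Dehom.mul_mem hf (RN.pow_mem w n))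
  exact ⟨a, ha.trans (Dehom.mk_congr rfl (add_comm _ _))⟩

end Stable

/-! ### The shifts of `A` as graded modules -/

namespace GrMod

variable {k : Type v} [Field k] {A : Type u} [Ring A] [Algebra k A] {𝒜 : ℤ → Submodule k A}

lemma _root_.GrAlg.IsConnected.eq_zero_of_neg (hc : IsConnected 𝒜) {i : ℤ} (x : 𝒜 i)
    (hi : i < 0) : x = 0 :=
  Subtype.ext ((Submodule.mem_bot k).1 ((hc.neg_eq_bot i hi).le x.2))

/-- The linear map underlying a morphism. -/
def lin {M N : GrMod 𝒜} (f : M ⟶ N) : M.carrier →ₗ[Aᵐᵒᵖ] N.carrier := Subtype.val f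

lemma lin_mem {M N : GrMod 𝒜} (f : M ⟶ N) {i : ℤ} {m : M.carrier} (hm : m ∈ M.deg i) :
    lin f m ∈ N.deg i := Subtype.property f i m hm

lemma hom_ext_lin {M N : GrMod 𝒜} {f g : M ⟶ N} (h : lin f = lin g) : f = g := Subtype.ext h

lemma lin_comp {M N P : GrMod 𝒜} (f : M ⟶ N) (g : N ⟶ P) (m : M.carrier) :
    lin (f ≫ g) m = lin g (lin f m) := rfl

lemma lin_id {M : GrMod 𝒜} (m : M.carrier) : lin (𝟙 M) m = m := rfl

lemma lin_zero {M N : GrMod 𝒜} (m : M.carrier) : lin (0 : M ⟶ N) m = 0 := rfl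

lemma lin_smul {M N : GrMod 𝒜} (c : k) (f : M ⟶ N) (m : M.carrier) :
    lin (c • f) m = c • lin f m := rfl

lemma lin_map_smul {M N : GrMod 𝒜} (f : M ⟶ N) (c : k) (m : M.carrier) :
    lin f (c • m) = c • lin f m := LinearMap.map_smul_of_tower (lin f) c m

/-- Morphisms that agree on homogeneous elements are equal. -/
lemma hom_ext_deg {M N : GrMod 𝒜} {f g : M ⟶ N}
    (h : ∀ (i : ℤ) (m : M.carrier), m ∈ M.deg i → lin f m = lin g m) : f = g := by
  refine hom_ext_lin (LinearMap.ext fun m => ?_)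
  have hm : m ∈ ⨆ i, M.deg i := by
    rw [M.isInternal.submodule_iSup_eq_top]; exact Submodule.mem_top
  induction hm using Submodule.iSup_induction' with
  | mem i x hx => exact h i x hx
  | zero => rw [map_zero, map_zero]
  | add x y _ _ hx hy => rw [map_add, map_add, hx, hy]

variable [GradedAlgebra 𝒜]

variable (𝒜) in
/-- The shift `A(i)`, with `A(i)_n = A_{i+n}`. -/
abbrev shift (i : ℤ) : GrMod 𝒜 where
  carrier := A
  deg n := 𝒜 (i + n)
  isInternal := by
    have h := DirectSum.Decomposition.isInternal 𝒜
    rw [DirectSum.isInternal_submodule_iff_iSupIndep_and_iSup_eq_top] at h ⊢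
    exact ⟨h.1.comp (add_right_injective i),
      ((Equiv.addLeft i).iSup_comp (g := 𝒜)).trans h.2⟩
  smul_mem n j m a hm ha := by
    rw [← add_assoc]
    exact SetLike.mul_mem_graded hm ha

lemma one_mem_shift (i : ℤ) : (1 : A) ∈ (shift 𝒜 i).deg (-i) := by
  change (1 : A) ∈ 𝒜 (i + -i)
  rw [add_neg_cancel]
  exact SetLike.one_mem_graded 𝒜

/-- The morphism `A(i) → N` that sends `1` to `x`. -/
def ofElt {N : GrMod 𝒜} {i : ℤ} (x : N.carrier) (hx : x ∈ N.deg (-i)) : shift 𝒜 i ⟶ N :=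
  ⟨{ toFun := fun a : A => MulOpposite.op a • x
     map_add' := fun a b => by rw [MulOpposite.op_add, add_smul]
     map_smul' := fun b a => by
      change MulOpposite.op (a * b.unop) • x = b • MulOpposite.op a • x
      rw [MulOpposite.op_mul, mul_smul, MulOpposite.op_unop] },
   fun n a ha => by
    have := N.smul_mem (-i) (i + n) x a hx ha
    rwa [neg_add_cancel_left] at this⟩

lemma lin_ofElt {N : GrMod 𝒜} {i : ℤ} (x : N.carrier) (hx : x ∈ N.deg (-i)) (a : A) :
    lin (ofElt x hx) a = MulOpposite.op a • x := rfl

lemma lin_ofElt_one {N : GrMod 𝒜} {i : ℤ} (x : N.carrier) (hx : x ∈ N.deg (-i)) :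
    lin (ofElt x hx) (1 : A) = x := by rw [lin_ofElt, MulOpposite.op_one, one_smul]

lemma lin_shift {N : GrMod 𝒜} {i : ℤ} (f : shift 𝒜 i ⟶ N) (a : A) :
    lin f a = MulOpposite.op a • lin f (1 : A) := by
  rw [← map_smul]
  congr 1
  exact (one_mul a).symm

lemma shift_hom_ext {N : GrMod 𝒜} {i : ℤ} {f g : shift 𝒜 i ⟶ N}
    (h : lin f (1 : A) = lin g (1 : A)) : f = g :=
  hom_ext_lin (LinearMap.ext fun a => by rw [lin_shift f, lin_shift g, h])

/-- The shifts of `A` separate morphisms. -/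
lemma hom_ext_shift {M N : GrMod 𝒜} {f g : M ⟶ N}
    (h : ∀ (j : ℤ) (p : shift 𝒜 j ⟶ M), p ≫ f = p ≫ g) : f = g := by
  refine hom_ext_deg fun i m hm => ?_
  have hm' : m ∈ M.deg (- -i) := by rwa [neg_neg]
  have := congrArg (fun q => lin q (1 : A)) (h (-i) (ofElt m hm'))
  change lin f (lin (ofElt m hm') (1 : A)) = lin g (lin (ofElt m hm') (1 : A)) at this
  rwa [lin_ofElt_one] at this

lemma lin_shift_one_mem {i j : ℤ} (f : shift 𝒜 i ⟶ shift 𝒜 j) :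
    (lin f (1 : A) : A) ∈ 𝒜 (j - i) := lin_mem f (one_mem_shift i)

/-- Left multiplication by an element of `A_{j-i}` as a morphism `A(i) → A(j)`. -/
def mulLeft {i j : ℤ} (a : 𝒜 (j - i)) : shift 𝒜 i ⟶ shift 𝒜 j :=
  ofElt (N := shift 𝒜 j) a.1 a.2

variable (𝒜) in
/-- `Hom(A(i), A(j)) = A_{j-i}`. -/
def shiftHomEquiv (i j : ℤ) : (shift 𝒜 i ⟶ shift 𝒜 j) ≃ₗ[k] 𝒜 (j - i) where
  toFun f := ⟨lin f (1 : A), lin_shift_one_mem f⟩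
  map_add' _ _ := rfl
  map_smul' _ _ := rfl
  invFun := mulLeft
  left_inv f := shift_hom_ext (mul_one (lin f (1 : A) : A))
  right_inv a := Subtype.ext (mul_one a.1)

/-- Morphisms of shifts are left multiplications, so composition in diagrammatic order reverses the
product. -/
lemma shiftHomEquiv_comp {i j l : ℤ} (f : shift 𝒜 i ⟶ shift 𝒜 j) (g : shift 𝒜 j ⟶ shift 𝒜 l) :
    (shiftHomEquiv 𝒜 i l (f ≫ g)).1 = (shiftHomEquiv 𝒜 j l g).1 * (shiftHomEquiv 𝒜 i j f).1 :=
  lin_shift g (lin f (1 : A))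

lemma exists_eq_smul_id (hc : IsConnected 𝒜) {i : ℤ} (f : shift 𝒜 i ⟶ shift 𝒜 i) :
    ∃ c : k, f = c • 𝟙 _ := by
  have h := lin_shift_one_mem f
  rw [sub_self, ← SetLike.mem_coe, hc.zero_eq] at h
  obtain ⟨c, hc⟩ := h
  refine ⟨c, shift_hom_ext ?_⟩
  rw [lin_smul, lin_id, ← hc]
  exact Algebra.algebraMap_eq_smul_one c

/-! ### The simple quotient of `A(i)` -/

/-- Without negative degrees, homogeneous factors with a nonzero product in degree `0` must both
have degree `0`. -/
lemma decompose_mul_zero (hc : IsConnected 𝒜) (a b : A) :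
    DirectSum.decompose 𝒜 (a * b) 0 = DirectSum.decompose 𝒜 a 0 * DirectSum.decompose 𝒜 b 0 := by
  induction a using DirectSum.Decomposition.inductionOn 𝒜 with
  | zero => simp
  | add x y hx hy => simp only [add_mul, DirectSum.decompose_add, DirectSum.add_apply, hx, hy]
  | @homogeneous i x =>
    induction b using DirectSum.Decomposition.inductionOn 𝒜 with
    | zero => simp
    | add y z hy hz => simp only [mul_add, DirectSum.decompose_add, DirectSum.add_apply, hy, hz]
    | @homogeneous j y =>
      apply Subtype.ext
      rcases lt_trichotomy i 0 with hi | rfl | hi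
      · simp [hc.eq_zero_of_neg x hi]
      · have := DirectSum.coe_decompose_mul_add_of_left_mem 𝒜 (b := y.1) (j := 0) x.2
        rw [add_zero] at this
        rw [this]
        simp
      · rcases lt_or_ge j 0 with hj | hj
        · simp [hc.eq_zero_of_neg y hj]
        · rw [DirectSum.decompose_of_mem_ne 𝒜 (SetLike.mul_mem_graded x.2 y.2) (by omega)]
          simp [DirectSum.of_eq_of_ne _ _ _ hi.ne]

/-- The augmentation `A → A_0` of a connected graded algebra. -/
def augmentation (hc : IsConnected 𝒜) : A →+* 𝒜 0 where
  toFun a := DirectSum.decompose 𝒜 a 0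
  map_one' := by simp [DirectSum.decompose_one, DirectSum.one_def]; rfl
  map_mul' := decompose_mul_zero hc
  map_zero' := by simp
  map_add' a b := by simp

/-- `A_0` as a right module through the augmentation, concentrated in degree `-i`. -/
def simple (hc : IsConnected 𝒜) (i : ℤ) : GrMod 𝒜 :=
  letI : Module Aᵐᵒᵖ (𝒜 0) := Module.compHom (𝒜 0) (augmentation hc).op
  haveI : IsScalarTower k Aᵐᵒᵖ (𝒜 0) := ⟨fun c a x => by
    change x * augmentation hc (c • a.unop) = c • (x * augmentation hc a.unop)
    have : augmentation hc (c • a.unop) = c • augmentation hc a.unop := by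
      change DirectSum.decompose 𝒜 _ 0 = _
      rw [DirectSum.decompose_smul]
      rfl
    rw [this]
    exact Subtype.ext (mul_smul_comm _ _ _)⟩
  { carrier := 𝒜 0
    deg := fun n => if n = -i then ⊤ else ⊥
    isInternal := by
      rw [DirectSum.isInternal_submodule_iff_iSupIndep_and_iSup_eq_top]
      refine ⟨fun n => ?_, top_unique ?_⟩
      · by_cases hn : n = -i
        · rw [disjoint_iff, eq_bot_iff]
          refine inf_le_right.trans (iSup₂_le fun j hj => ?_)
          exact (if_neg (fun h => hj (h.trans hn.symm))).le
        · simp only [if_neg hn]; exact disjoint_bot_left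
      · refine le_trans ?_ (le_iSup _ (-i))
        rw [if_pos rfl]
    smul_mem := fun n j x a hx ha => by
      change x * augmentation hc a ∈ _
      split_ifs at hx with hn
      · by_cases hj : j = 0
        · rw [if_pos (by omega)]; exact Submodule.mem_top
        · have : augmentation hc a = 0 := Subtype.ext (DirectSum.decompose_of_mem_ne 𝒜 ha hj)
          rw [this, mul_zero]; exact Submodule.zero_mem _
      · rw [(Submodule.mem_bot k).1 hx, zero_mul]; exact Submodule.zero_mem _ }

lemma mem_simple_deg {hc : IsConnected 𝒜} {i n : ℤ} {x : (simple hc i).carrier}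
    (hx : x ∈ (simple hc i).deg n) (h0 : x ≠ 0) : n = -i := by
  by_contra hn
  change x ∈ (if n = -i then ⊤ else ⊥ : Submodule k (𝒜 0)) at hx
  rw [if_neg hn] at hx
  exact h0 ((Submodule.mem_bot k).1 hx)

/-- The projection of `A(i)` onto its simple quotient. -/
def toSimple (hc : IsConnected 𝒜) (i : ℤ) : shift 𝒜 i ⟶ simple hc i :=
  ofElt (N := simple hc i) (1 : 𝒜 0) (by
    change (1 : 𝒜 0) ∈ (if -i = -i then ⊤ else ⊥ : Submodule k (𝒜 0))
    rw [if_pos rfl]; exact Submodule.mem_top)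

lemma toSimple_ne_zero (hc : IsConnected 𝒜) (i : ℤ) : toSimple hc i ≠ 0 := by
  intro h
  have h1 : lin (toSimple hc i) (1 : A) = 0 := by rw [h]; rfl
  have h2 : (1 : 𝒜 0) = 0 := (lin_ofElt_one (N := simple hc i) _ _).symm.trans h1
  have := hc.nontrivial
  exact one_ne_zero (congrArg Subtype.val h2)

/-- A morphism `M → A(i)` that is nonzero on the simple quotient is a split epimorphism. -/
lemma exists_section (hc : IsConnected 𝒜) {M : GrMod 𝒜} {i : ℤ} (p : M ⟶ shift 𝒜 i)
    (hp : p ≫ toSimple hc i ≠ 0) : ∃ s : shift 𝒜 i ⟶ M, s ≫ p = 𝟙 _ := by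
  obtain ⟨n, m, hm, hne⟩ : ∃ (n : ℤ) (m : M.carrier), m ∈ M.deg n ∧
      lin (p ≫ toSimple hc i) m ≠ 0 := by
    by_contra hcon
    push Not at hcon
    exact hp (hom_ext_deg fun n m hm => (hcon n m hm).trans (lin_zero m).symm)
  -- The simple module lives in degree `-i` only, so `p m` lies in `A_0 = k`. It is a nonzero scalar
  -- `c`, and the section sends `1` to `c⁻¹ m`.
  obtain rfl := mem_simple_deg (lin_mem _ hm) hne
  have hpm : (lin p m : A) ∈ 𝒜 (i + -i) := lin_mem p hm
  rw [add_neg_cancel, ← SetLike.mem_coe, hc.zero_eq] at hpm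
  obtain ⟨c, hcm⟩ := hpm
  have hc0 : c ≠ 0 := by
    rintro rfl
    apply hne
    rw [lin_comp, ← hcm, map_zero]
    exact map_zero (lin (toSimple hc i))
  refine ⟨ofElt (c⁻¹ • m) (Submodule.smul_mem _ _ hm), shift_hom_ext ?_⟩
  rw [lin_comp, lin_ofElt_one, lin_map_smul, lin_id, ← hcm]
  change c⁻¹ • algebraMap k A c = 1
  rw [Algebra.algebraMap_eq_smul_one, smul_smul, inv_mul_cancel₀ hc0, one_smul]

/-- A `k`-linear equivalence maps shifts of `A` to shifts of `A'`. -/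
theorem exists_iso_shift {A' : Type u} [Ring A'] [Algebra k A'] {𝒜' : ℤ → Submodule k A'}
    [GradedAlgebra 𝒜'] (hc : IsConnected 𝒜) (hc' : IsConnected 𝒜')
    (e : GrMod 𝒜 ≌ GrMod 𝒜') [e.functor.Additive] [e.functor.Linear k] (i : ℤ) :
    ∃ j : ℤ, Nonempty (e.functor.obj (shift 𝒜 i) ≅ shift 𝒜' j) := by
  -- The image of the nonzero `toSimple` is nonzero by faithfulness, hence detected by some shift of
  -- `A'`.
  obtain ⟨j, h, hh⟩ : ∃ (j : ℤ) (h : shift 𝒜' j ⟶ e.functor.obj (shift 𝒜 i)),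
      h ≫ e.functor.map (toSimple hc i) ≠ 0 := by
    by_contra hcon
    push Not at hcon
    refine toSimple_ne_zero hc i (e.functor.map_injective ?_)
    rw [Functor.map_zero]
    exact hom_ext_shift fun j p => by rw [hcon j p, Limits.comp_zero]
  let β : e.functor.obj (e.inverse.obj (shift 𝒜' j)) ≅ shift 𝒜' j := e.counitIso.app _
  let p : e.inverse.obj (shift 𝒜' j) ⟶ shift 𝒜 i := e.functor.preimage (β.hom ≫ h)
  have hp : p ≫ toSimple hc i ≠ 0 := by
    intro h0
    have h1 := congrArg e.functor.map h0
    rw [Functor.map_comp, Functor.map_preimage, Functor.map_zero, Category.assoc] at h1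
    apply hh
    rw [← β.inv_hom_id_assoc (h ≫ _), h1, Limits.comp_zero]
  obtain ⟨s, hs⟩ := exists_section hc p hp
  have hp0 : p ≠ 0 := by rintro h0; exact hp (by rw [h0, Limits.zero_comp])
  -- The idempotent `p ≫ s` is a scalar, because the endomorphisms of `A'(j)` are scalars; as `s ≫ p
  -- = 𝟙` and `p ≠ 0`, that scalar is `1`.
  obtain ⟨c, hcs⟩ := exists_eq_smul_id hc' (β.inv ≫ e.functor.map (p ≫ s) ≫ β.hom)
  have hps : p ≫ s = c • 𝟙 _ := by
    apply e.functor.map_injective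
    rw [Iso.inv_comp_eq, ← Iso.eq_comp_inv] at hcs
    rw [hcs, Functor.map_smul, CategoryTheory.Functor.map_id]
    simp
  have hcp : c • p = p := by
    have : (p ≫ s) ≫ p = p := by rw [Category.assoc, hs, Category.comp_id]
    rwa [hps, Linear.smul_comp, Category.id_comp] at this
  have hc1 : c = 1 := by
    have : (c - 1) • p = 0 := by rw [sub_smul, one_smul, hcp, sub_self]
    exact sub_eq_zero.1 ((smul_eq_zero.1 this).resolve_right hp0)
  rw [hc1, one_smul] at hps
  exact ⟨j, ⟨e.functor.mapIso ⟨s, p, hs, hps⟩ ≪≫ β⟩⟩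

end GrMod

/-! ### The comparison of dehomogenizations -/

section Comparison

variable {k : Type v} [Field k] {A : Type u} [Ring A] [Algebra k A]
  {𝒜 : ℤ → Submodule k A} [GradedAlgebra 𝒜]

namespace GrMod

variable {A' : Type u} [Ring A'] [Algebra k A'] {𝒜' : ℤ → Submodule k A'} [GradedAlgebra 𝒜']

/-- A `k`-linear equivalence identifies the components of `A` and `A'`, up to reindexing. -/
theorem exists_linearEquiv_shift (hc : IsConnected 𝒜) (hc' : IsConnected 𝒜')
    (e : GrMod 𝒜 ≌ GrMod 𝒜') [e.functor.Additive] [e.functor.Linear k] :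
    ∃ (σ : ℤ → ℤ) (φ : ∀ i j, 𝒜 (j - i) ≃ₗ[k] 𝒜' (σ j - σ i)),
      ∀ (i j l : ℤ) (a : 𝒜 (l - j)) (b : 𝒜 (j - i)) (c : 𝒜 (l - i)), c.1 = a.1 * b.1 →
        (φ i l c).1 = (φ j l a).1 * (φ i j b).1 := by
  choose σ hσ using exists_iso_shift hc hc' e
  let α : ∀ i, e.functor.obj (shift 𝒜 i) ≅ shift 𝒜' (σ i) := fun i => (hσ i).some
  let ψ : ∀ i j, (shift 𝒜 i ⟶ shift 𝒜 j) ≃ₗ[k] (shift 𝒜' (σ i) ⟶ shift 𝒜' (σ j)) := fun i j =>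
    LinearEquiv.ofBijective (e.functor.mapLinearMap k) (e.fullyFaithfulFunctor.map_bijective _ _)
      ≪≫ₗ Linear.homCongr k (α i) (α j)
  have hψ : ∀ i j f, ψ i j f = ((α i).inv ≫ e.functor.map f) ≫ (α j).hom := fun i j f => rfl
  refine ⟨σ, fun i j => (shiftHomEquiv 𝒜 i j).symm ≪≫ₗ ψ i j ≪≫ₗ shiftHomEquiv 𝒜' (σ i) (σ j), ?_⟩
  intro i j l a b c habc
  simp only [LinearEquiv.trans_apply]
  rw [← shiftHomEquiv_comp]
  congr 2
  have hcomp : (shiftHomEquiv 𝒜 i l).symm c =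
      (shiftHomEquiv 𝒜 i j).symm b ≫ (shiftHomEquiv 𝒜 j l).symm a := by
    rw [LinearEquiv.symm_apply_eq]
    apply Subtype.ext
    rw [shiftHomEquiv_comp, LinearEquiv.apply_symm_apply, LinearEquiv.apply_symm_apply, habc]
  rw [hcomp, hψ, hψ, hψ]
  simp

/-- A `k`-linear equivalence identifies `A_n = Hom(A(-m-n), A(-m))` with a homogeneous component
of `A'` of degree at least `n`, compatibly with products. -/
theorem exists_linearEquiv_component (hc : IsConnected 𝒜) (hc' : IsConnected 𝒜')
    (e : GrMod 𝒜 ≌ GrMod 𝒜') [e.functor.Additive] [e.functor.Linear k] (w : RN 𝒜 1) :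
    ∃ (d : ℕ → ℕ → ℕ) (ψ : ∀ m n : ℕ, 𝒜 (n : ℤ) ≃ₗ[k] 𝒜' (d m n : ℤ)),
      (∀ m n, n ≤ d m n) ∧ (∀ m n r, d m (n + r) = d m n + d (m + n) r) ∧
      ∀ (m n r : ℕ) (a : 𝒜 (n : ℤ)) (b : 𝒜 (r : ℤ)) (c : 𝒜 ((n + r : ℕ) : ℤ)),
        c.1 = a.1 * b.1 → (ψ m (n + r) c).1 = (ψ m n a).1 * (ψ (m + n) r b).1 := by
  obtain ⟨σ, φ, hφ⟩ := exists_linearEquiv_shift hc hc' e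
  have := hc.nontrivial
  have := hc'.nontrivial
  -- The image of `w` is a nonzero element of degree `σ (i+1) - σ i`, so this is not negative. Were
  -- it zero, `1 ∈ A'_0` would correspond to a nonzero element of `A_{-1} = 0`.
  have hσ : StrictMono σ := strictMono_int_of_lt_succ fun i => by
    have hw : w.1 ∈ 𝒜 (i + 1 - i) := by rw [add_sub_cancel_left]; exact w.2.1
    have h1 : φ i (i + 1) ⟨w.1, hw⟩ ≠ 0 := fun h =>
      w.2.2.1.ne_zero (congrArg Subtype.val ((LinearEquiv.map_eq_zero_iff _).1 h))
    have h2 : 0 ≤ σ (i + 1) - σ i := by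
      by_contra hlt
      exact h1 (hc'.eq_zero_of_neg _ (not_le.1 hlt))
    refine lt_of_le_of_ne (by omega) fun heq => ?_
    have h3 : (1 : A') ∈ 𝒜' (σ i - σ (i + 1)) := by
      rw [heq, sub_self]; exact SetLike.one_mem_graded 𝒜'
    have h4 : (φ (i + 1) i).symm ⟨1, h3⟩ = 0 := hc.eq_zero_of_neg _ (by omega)
    exact one_ne_zero (congrArg Subtype.val ((LinearEquiv.map_eq_zero_iff _).1 h4))
  have hle : ∀ (i : ℤ) (n : ℕ), (n : ℤ) ≤ σ i - σ (i - n) := by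
    intro i n
    induction n with
    | zero => simp
    | succ n ih =>
      have : σ (i - (n + 1 : ℕ)) < σ (i - n) := hσ (by push_cast; omega)
      push_cast at this ⊢
      omega
  have hd : ∀ m n : ℕ, ((σ (-m) - σ (-m - n)).toNat : ℤ) = σ (-m) - σ (-m - n) := fun m n =>
    Int.toNat_of_nonneg (le_trans (by positivity) (hle (-m) n))
  have hidx : ∀ m n : ℕ, (-(m : ℤ) - n) = -((m + n : ℕ) : ℤ) := fun m n => by push_cast; ring
  let ψ : ∀ m n : ℕ, 𝒜 (n : ℤ) ≃ₗ[k] 𝒜' ((σ (-m) - σ (-m - n)).toNat : ℤ) := fun m n =>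
    LinearEquiv.ofEq _ _ (congrArg 𝒜 (sub_sub_cancel (-(m : ℤ)) n).symm) ≪≫ₗ
      φ (-m - n) (-m) ≪≫ₗ LinearEquiv.ofEq _ _ (congrArg 𝒜' (hd m n).symm)
  -- Leaving `i` and `j` free up to equality lets the indices match those needed to compose.
  have hψ : ∀ (m n : ℕ) (i j : ℤ) (_ : i = -m - n) (_ : j = -m) (a : 𝒜 (n : ℤ))
      (a' : 𝒜 (j - i)), a.1 = a'.1 → (ψ m n a).1 = (φ i j a').1 := by
    rintro m n i j rfl rfl a a' h
    have : LinearEquiv.ofEq _ _ (congrArg 𝒜 (sub_sub_cancel (-(m : ℤ)) n).symm) a = a' :=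
      Subtype.ext h
    simp only [ψ, LinearEquiv.trans_apply, this]
    rfl
  refine ⟨fun m n => (σ (-m) - σ (-m - n)).toNat, ψ, fun m n => ?_, fun m n r => ?_, ?_⟩
  · have := hle (-m) n
    have := hd m n
    dsimp only
    omega
  · apply Nat.cast_injective (R := ℤ)
    rw [Nat.cast_add, hd, hd, hd, ← hidx m n, Nat.cast_add, ← sub_sub]
    ring
  · intro m n r a b c h
    have ha : a.1 ∈ 𝒜 (-(m : ℤ) - (-m - n)) := by rw [sub_sub_cancel]; exact a.2
    have hb : b.1 ∈ 𝒜 ((-m - n) - (-(m : ℤ) - n - r)) := by rw [sub_sub_cancel]; exact b.2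
    have hcc : c.1 ∈ 𝒜 (-(m : ℤ) - (-m - n - r)) := by
      convert c.2 using 2; push_cast; ring
    rw [hψ m n _ _ rfl rfl a ⟨a.1, ha⟩ rfl,
      hψ (m + n) r _ _ (by push_cast; ring) (hidx m n) b ⟨b.1, hb⟩ rfl,
      hψ m (n + r) _ _ (by push_cast; ring) rfl c ⟨c.1, hcc⟩ rfl]
    exact hφ _ _ _ _ _ _ h

end GrMod

/-- Multiplication on the right by a homogeneous element, inside the dehomogenization. -/
lemma Dehom.exists_nu_pow_eq (w : RN 𝒜 1) (n : ℕ) {r : ℕ} {b : A} (hb : b ∈ 𝒜 (r : ℤ)) :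
    ∃ b' ∈ 𝒜 (r : ℤ), (RN.nu w ^ n) b' = b := by
  obtain ⟨b', rfl⟩ := (RN.nu w ^ n).surjective b
  refine ⟨b', ?_, rfl⟩
  -- The product `b' wⁿ = wⁿ b` is homogeneous, and cancelling the regular `wⁿ` forces `b'` to be
  -- homogeneous too.
  have h1 : b' * w.1 ^ n ∈ 𝒜 ((r : ℤ) + n) := by
    rw [RN.mul_pow_eq w, add_comm]
    exact SetLike.mul_mem_graded (RN.pow_mem w n) hb
  have h2 := DirectSum.coe_decompose_mul_add_of_right_mem 𝒜 (a := b') (i := (r : ℤ))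
    (RN.pow_mem w n)
  rw [DirectSum.decompose_of_mem_same 𝒜 h1] at h2
  rw [RN.right_cancel_pow w n h2]
  exact SetLike.coe_mem _

/-- Graded Morita equivalent algebras have isomorphic dehomogenizations. -/
theorem Dehom.nonempty_algEquiv_of_equivalence
    {A' : Type u} [Ring A'] [Algebra k A'] {𝒜' : ℤ → Submodule k A'} [GradedAlgebra 𝒜']
    (hc : IsConnected 𝒜) (hc' : IsConnected 𝒜') (hgen' : IsFinGenInDegreeOne 𝒜')
    (hGK' : GKdim 𝒜' = 1) (e : GrMod 𝒜 ≌ GrMod 𝒜') [e.functor.Additive] [e.functor.Linear k]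
    (w : RN 𝒜 1) (w' : RN 𝒜' 1) : Nonempty (Dehom w ≃ₐ[k] Dehom w') := by
  obtain ⟨d, ψ, hle, hd, hψ⟩ := GrMod.exists_linearEquiv_component hc hc' e w
  obtain ⟨N, hfin, hN⟩ := RN.exists_mulRight_surjective hGK' w'
  have hsurj : ∀ m, N ≤ m → Function.Surjective (Dehom.mkLin w' m) := fun m hm =>
    Dehom.mkLin_surjective w' fun l hl =>
      RN.mulRight_surjective_of_le hgen' w' hN (hm.trans hl)
  have : Module.Finite k (Dehom w') := Module.Finite.of_surjective _ (hsurj N le_rfl)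
  -- The product of fractions twists its right factor by a power of `ν`; `b'` is the preimage of `ψ
  -- b` that undoes this twist.
  have hmul : ∀ (n m : ℕ) (a : 𝒜 (n : ℤ)) (b : 𝒜 (m : ℤ)) (b' : A') (hb' : b' ∈ 𝒜' (d (0 + n) m : ℤ)),
      (RN.nu w' ^ d 0 n) b' = (ψ (0 + n) m b).1 →
      Dehom.mkLin w' _ (ψ 0 (n + m) ⟨a.1 * b.1, Dehom.mul_mem a.2 b.2⟩) =
        Dehom.mkLin w' _ (ψ 0 n a) * Dehom.mk w' b' _ hb' := by
    intro n m a b b' hb' h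
    change Dehom.mk _ _ _ _ = Dehom.mk _ _ _ _ * _
    rw [Dehom.mk_mul]
    exact Dehom.mk_congr (by rw [h]; exact hψ 0 n m a b _ rfl) (hd 0 n m)
  refine Dehom.nonempty_algEquiv w (fun n => (Dehom.mkLin w' (d 0 n)).comp (ψ 0 n).toLinearMap)
    (fun n => (Dehom.mkLin_injective w' _).comp (ψ 0 n).injective) ?_ ?_ ?_
  · intro n m b
    obtain ⟨b', hb', h⟩ := Dehom.exists_nu_pow_eq w' (d 0 n) (ψ (0 + n) m b).2
    exact ⟨Dehom.mk w' b' _ hb', fun a => hmul n m a b b' hb' h⟩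
  · intro n
    set x : Dehom w' := Dehom.mkLin w' _ (ψ 0 n ⟨w.1 ^ n, RN.pow_mem w n⟩) with hx
    change IsUnit x
    -- Since `d (0 + n) r ≥ r`, expanding `y` by a power of `w'` brings its numerator into a degree
    -- reached by `ψ`. Then `x y` is the image of some `wⁿ h`, and `wⁿ` is regular in `A`.
    have hreg : ∀ y : Dehom w', x * y = 0 → y = 0 := by
      refine Dehom.ind fun g r hg hxy => ?_
      obtain ⟨t, ht⟩ := Nat.exists_eq_add_of_le (hle (0 + n) r)
      have hg' : g * w'.1 ^ t ∈ 𝒜' (d (0 + n) r : ℤ) := by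
        rw [ht]; exact Dehom.mul_mem hg (RN.pow_mem w' t)
      have hy : Dehom.mk w' g r hg = Dehom.mk w' (g * w'.1 ^ t) _ hg' :=
        (Dehom.mk_mul_pow w' g r t hg).trans (Dehom.mk_congr rfl ht.symm)
      rw [hy] at hxy ⊢
      obtain ⟨h, hh⟩ := (ψ (0 + n) r).surjective ⟨_, RN.nu_pow_mem w' (d 0 n) hg'⟩
      rw [hx, ← hmul n r ⟨w.1 ^ n, RN.pow_mem w n⟩ h _ hg' (congrArg Subtype.val hh).symm,
        map_eq_zero_iff _ (Dehom.mkLin_injective w' _), LinearEquiv.map_eq_zero_iff] at hxy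
      have h0 : h = 0 := by
        have : w.1 ^ n * h.1 = w.1 ^ n * 0 := (congrArg Subtype.val hxy).trans (mul_zero _).symm
        exact Subtype.ext ((w.2.2.1.pow n).left this)
      rw [h0, map_zero] at hh
      have hg0 : g * w'.1 ^ t = 0 := by
        have := congrArg Subtype.val hh.symm
        exact (map_eq_zero_iff _ (RN.nu w' ^ d 0 n).injective).1 this
      rw [Dehom.zero_def, Dehom.mk_eq, hg0, zero_mul, zero_mul]
    have hinj : Function.Injective (LinearMap.mulLeft k x) :=
      (injective_iff_map_eq_zero _).2 hreg
    -- Finite dimension yields a right inverse `y`, and `x (y x - 1) = 0` makes it two-sided.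
    obtain ⟨y, hy⟩ := LinearMap.injective_iff_surjective.1 hinj 1
    have hxy : x * y = 1 := hy
    refine ⟨⟨x, y, hxy, sub_eq_zero.1 (hreg _ ?_)⟩, rfl⟩
    rw [mul_sub, ← mul_assoc, hxy, one_mul, mul_one, sub_self]
  · intro y
    -- As `d 0 N ≥ N`, the map `θ_N` is already onto, so the single denominator `w ^ N` serves for
    -- every `y`.
    obtain ⟨c, hcy⟩ := hsurj (d 0 N) (hle 0 N)
      (y * Dehom.mkLin w' _ (ψ 0 N ⟨w.1 ^ N, RN.pow_mem w N⟩))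
    refine ⟨N, (ψ 0 N).symm c, ?_⟩
    simpa using hcy

end Comparison

end

end GrAlg

/-! ### The theorem -/

theorem mainTheorem9 {k : Type v} [Field k] [IsAlgClosed k] [CharZero k]
    {A : Type u} [Ring A] [Algebra k A] (𝒜 : ℤ → Submodule k A) [GradedAlgebra 𝒜]
    (hN : GrAlg.IsRightNoetherian A) (hconn : GrAlg.IsConnected 𝒜)
    (hgen : GrAlg.IsFinGenInDegreeOne 𝒜) (hGK : GrAlg.GKdim 𝒜 = 1) :
    (∀ (A' : Type u) [Ring A'] [Algebra k A'] (𝒜' : ℤ → Submodule k A') [GradedAlgebra 𝒜'],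
      GrAlg.IsRightNoetherian A' → GrAlg.IsConnected 𝒜' →
      GrAlg.IsFinGenInDegreeOne 𝒜' → GrAlg.GKdim 𝒜' = 1 →
      GrAlg.GrModEquivalent 𝒜 𝒜' →
      ∀ (w : GrAlg.RN 𝒜 1) (w' : GrAlg.RN 𝒜' 1),
        Nonempty (GrAlg.Dehom w ≃ₐ[k] GrAlg.Dehom w')) ∧
    (∀ w₁ w₂ : GrAlg.RN 𝒜 1, Nonempty (GrAlg.Dehom w₁ ≃ₐ[k] GrAlg.Dehom w₂)) := by
  refine ⟨?_, ?_⟩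
  · intro A' _ _ 𝒜' _ _ hconn' hgen' hGK' he w w'
    obtain ⟨e, _, _⟩ := he
    exact GrAlg.Dehom.nonempty_algEquiv_of_equivalence hconn hconn' hgen' hGK' e w w'
  · intro w₁ w₂
    have : (CategoryTheory.Equivalence.refl : GrAlg.GrMod 𝒜 ≌ GrAlg.GrMod 𝒜).functor.Additive :=
      inferInstanceAs (𝟭 _).Additive
    have : (CategoryTheory.Equivalence.refl : GrAlg.GrMod 𝒜 ≌ GrAlg.GrMod 𝒜).functor.Linear k :=
      inferInstanceAs ((𝟭 _).Linear k)
    exact GrAlg.Dehom.nonempty_algEquiv_of_equivalence hconn hconn hgen hGK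
      CategoryTheory.Equivalence.refl w₁ w₂
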